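/- Let $\mathbb S=\{z\in\mathbb C:|z|=1\}$. A continuous inverse algebra (cia) is a unital associative, locally convex, Hausdorff complex topological algebra (with jointly continuous multiplication) whose group of invertible elements is open and whose inversion map is continuous. A cia $\mathcal A\subseteq C(\mathbb S,\mathbb C)$ (a unital subalgebra with its own topology) is an $R$-cia if it contains the restrictions to $\mathbb S$ of all rational functions with poles off $\mathbb S$ and these are dense in $\mathcal A$. For an $R$-cia $\mathcal A$, let $\mathcal A^+$ and $\mathcal A^\ominus$ be the closures in $\mathcal A$ of $\mathbb C[z]$ and $z^{-1}\mathbb C[z^{-1}]$, respectively, and let $\mathcal A^-:=\mathbb C\mathbf 1+\mathcal A^\ominus$. The $R$-cia $\mathcal A$ is called decomposing if $\mathcal A=\mathcal A^+\oplus\mathcal A^\ominus$ as a topological vector space. A sequence $(x_n)_n$ in $\mathcal A$ is Mackey-Cauchy if there are a bounded set $B\subseteq\mathcal A$ and real numbers $t_{n,m}\to 0$ (as $n,m\to\infty$) with $x_n-x_m\in t_{n,m}B$ for all $n,m$; $\mathcal A$ is Mackey complete if every Mackey-Cauchy sequence converges in $\mathcal A$. Proposition 1.1. Let $\mathcal A\subseteq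 C(\mathbb S,\mathbb C)$ be a decomposing $R$-cia which is Mackey complete. Then every $g\in\mathcal A^\times$ can be written as $$g=g_+\,(\mathrm{id}_{\mathbb S})^{\kappa}\,g_-$$ with $g_+\in(\mathcal A^+)^\times$, $g_-\in(\mathcal A^-)^\times$ and some $\kappa\in\mathbb Z$. Moreover, in every such factorization $\kappa=\mathrm{ind}_0(g)$ is the winding number of $g$ with respect to the origin $0\in\mathbb C$. -/

import Mathlib

open Filter Topology

/-- A complex continuous inverse algebra: a unital associative complex topological algebra, locally
convex and Hausdorff, with jointly continuous multiplication, open group of units and continuous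
inversion on the units (`Ring.inverse a` is the inverse of a unit `a`). -/
class IsContinuousInverseAlgebra (A : Type*) [Ring A] [Algebra ℂ A] [TopologicalSpace A] : Prop
    extends IsTopologicalRing A, ContinuousSMul ℂ A, LocallyConvexSpace ℝ A, T2Space A where
  isOpen_units : IsOpen {a : A | IsUnit a}
  continuousOn_inverse : ContinuousOn (Ring.inverse : A → A) {a : A | IsUnit a}

/-- A Mackey-Cauchy sequence: `x n - x m ∈ t (n, m) • B` for some bounded set `B` and some double
sequence of reals `t (n, m)` tending to `0` as `n, m → ∞`. -/
def IsMackeyCauchy {E : Type*} [AddCommGroup E] [Module ℂ E] [TopologicalSpace E]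
    (x : ℕ → E) : Prop :=
  ∃ B : Set E, Bornology.IsVonNBounded ℂ B ∧ ∃ t : ℕ × ℕ → ℝ, Tendsto t atTop (𝓝 0) ∧
    ∀ n m : ℕ, ∃ b ∈ B, x n - x m = (t (n, m) : ℂ) • b

/-- Mackey completeness: every Mackey-Cauchy sequence converges. -/
def IsMackeyComplete (E : Type*) [AddCommGroup E] [Module ℂ E] [TopologicalSpace E] : Prop :=
  ∀ x : ℕ → E, IsMackeyCauchy x → ∃ y : E, Tendsto x atTop (𝓝 y)

/-- The restrictions to the unit circle of the rational functions with poles off the circle. -/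
def circleRational : Set C(Circle, ℂ) :=
  {f | ∃ p q : Polynomial ℂ, (∀ z : Circle, q.eval (z : ℂ) ≠ 0) ∧
    ∀ z : Circle, f z = p.eval (z : ℂ) / q.eval (z : ℂ)}

/-- The function `z ↦ z ^ n` on the unit circle, for an integer `n`. -/
noncomputable def circleZPow (n : ℤ) : C(Circle, ℂ) where
  toFun z := ((z ^ n : Circle) : ℂ)
  continuous_toFun := continuous_subtype_val.comp (continuous_zpow n)

section Algebra

variable {A : Type*} [CommRing A] [Algebra ℂ A] [TopologicalSpace A] [IsContinuousInverseAlgebra A]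

/-- The continuous inverse algebra `A`, viewed inside `C(𝕊, ℂ)` through the injective unital algebra
homomorphism `ι` and carrying its own topology, is an `R`-cia: it contains all restrictions to the
circle of rational functions with poles off the circle, and these are dense in `A` (for the topology
of `A`). -/
structure IsRCia (ι : A →ₐ[ℂ] C(Circle, ℂ)) : Prop where
  injective : Function.Injective ι
  rational_subset : circleRational ⊆ Set.range ι
  dense_rational : Dense (ι ⁻¹' circleRational)

/-- `A⁺`: the closure in `A` of `ℂ[z]`, the linear span of the `z ^ n` with `n ≥ 0`. -/
noncomputable def plusPart (ι : A →ₐ[ℂ] C(Circle, ℂ)) : Submodule ℂ A :=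
  ((Submodule.span ℂ (circleZPow '' {n : ℤ | 0 ≤ n})).comap ι.toLinearMap).topologicalClosure

/-- `A^⊖`: the closure in `A` of `z⁻¹ ℂ[z⁻¹]`, the linear span of the `z ^ n` with `n < 0`. -/
noncomputable def ominusPart (ι : A →ₐ[ℂ] C(Circle, ℂ)) : Submodule ℂ A :=
  ((Submodule.span ℂ (circleZPow '' {n : ℤ | n < 0})).comap ι.toLinearMap).topologicalClosure

/-- `A⁻ = ℂ 1 + A^⊖`. -/
noncomputable def minusPart (ι : A →ₐ[ℂ] C(Circle, ℂ)) : Submodule ℂ A :=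
  Submodule.span ℂ {(1 : A)} ⊔ ominusPart ι

/-- `A = A⁺ ⊕ A^⊖` as a topological vector space. -/
def IsDecomposing (ι : A →ₐ[ℂ] C(Circle, ℂ)) : Prop :=
  (plusPart ι).IsTopCompl (ominusPart ι)

end Algebra

/-- `a` is an invertible element of `S` (used for the unital subalgebras `S = A⁺` and `S = A⁻`):
both `a` and its inverse belong to `S`. -/
def IsUnitIn {A : Type*} [CommRing A] [Algebra ℂ A] (S : Submodule ℂ A) (a : A) : Prop :=
  a ∈ S ∧ ∃ b ∈ S, a * b = 1

/-- `k` is the winding number about `0` of the loop `t ↦ f (exp (i t))`, `0 ≤ t ≤ 2 π`, in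
`ℂ \ {0}`: the increment along the loop of a continuous logarithm of it is `2 π i k`. -/
def HasWindingNumber (f : C(Circle, ℂ)) (k : ℤ) : Prop :=
  ∃ l : C(ℝ, ℂ), (∀ t : ℝ, Complex.exp (l t) = f (Circle.exp t)) ∧
    l (2 * Real.pi) - l 0 = k * (2 * Real.pi * Complex.I)

/-- The winding number is unique. -/
theorem HasWindingNumber.unique {f : C(Circle, ℂ)} {k k' : ℤ} (h : HasWindingNumber f k)
    (h' : HasWindingNumber f k') : k = k' := by
  obtain ⟨l, hl, hk⟩ := h
  obtain ⟨l', hl', hk'⟩ := h'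
  have hpi : (2 * Real.pi * Complex.I : ℂ) ≠ 0 := Complex.two_pi_I_ne_zero
  have key : ∀ t : ℝ, ∃ n : ℤ, (l t - l' t) / (2 * Real.pi * Complex.I) = n := by
    intro t
    have h1 : Complex.exp (l t) = Complex.exp (l' t) := by rw [hl, hl']
    obtain ⟨n, hn⟩ := Complex.exp_eq_exp_iff_exists_int.mp h1
    refine ⟨n, ?_⟩
    rw [hn]
    field_simp
    ring
  choose n hn using key
  have hre : ∀ t, ((l t - l' t) / (2 * Real.pi * Complex.I)).re = n t := by
    intro t
    rw [hn t]
    simp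
  have hcn : Continuous n := by
    rw [Int.isClosedEmbedding_coe_real.isEmbedding.continuous_iff]
    have : ((fun m : ℤ => (m : ℝ)) ∘ n) =
        fun t => ((l t - l' t) / (2 * Real.pi * Complex.I)).re := by
      funext t
      exact (hre t).symm
    rw [this]
    fun_prop
  have hconst : n (2 * Real.pi) = n 0 := PreconnectedSpace.constant inferInstance hcn
  have e1 := hn (2 * Real.pi)
  have e2 := hn 0
  rw [hconst, ← e2, div_left_inj' hpi] at e1
  have e3 : (k : ℂ) * (2 * Real.pi * Complex.I) = k' * (2 * Real.pi * Complex.I) := by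
    rw [← hk, ← hk']
    linear_combination e1
  exact_mod_cast mul_right_cancel₀ hpi e3

/-! ### Seminorms and Mackey convergence -/

section LocallyConvex

variable {E : Type*} [AddCommGroup E] [Module ℂ E] [TopologicalSpace E]

/-! By density a unit `g` has a rational unit `r` so near that `g r⁻¹` is close to `1`, hence equal
to `exp u`. Splitting `u = v + w` along `A⁺ ⊕ A^⊖` gives `exp u = exp v * exp w`, whose inverses are
`exp (-v)` and `exp (-w)`. The rational unit is a quotient of products of factors `z - a` with `‖a‖
≠ 1`, each factored by hand. As `A` is commutative, the pieces multiply.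

Logarithms, exponentials and Neumann series must converge without a norm. If `1 - w a` is invertible
for `‖w‖ ≤ R`, Cauchy's formula for the resolvent bounds the powers of `R a`, so `∑ c k • a ^ k`
converges by Mackey completeness once `∑ ‖c k‖ / R ^ k < ∞` (`exists_tendsto_powerSeries`). Such
sums stay in `A⁺` or `A⁻`, and their identities are checked pointwise on the circle, since `ι` is
injective and continuous.

For the index, units of `A⁺` are invertible in the uniform closure of the polynomials and have a
continuous logarithm on the circle (`exists_continuous_log`); reflection treats `A⁻`. Only `z ^ κ`
then winds around `0`. -/

open scoped ComplexOrder in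
theorem locallyConvexSpace_complex [LocallyConvexSpace ℝ E] : LocallyConvexSpace ℂ E := by
  refine ⟨fun x => ?_⟩
  refine (LocallyConvexSpace.convex_basis (𝕜 := ℝ) x).congr (fun s => ?_) (fun _ _ => rfl)
  refine and_congr_right fun _ => ⟨fun h => ?_, fun h => ?_⟩
  -- In `ComplexOrder` the nonnegative scalars are the nonnegative reals, so both notions of
  -- convexity agree.
  · refine convex_of_nonneg_surjective_algebraMap (R := ℝ) _ (fun c hc => ?_) h
    obtain ⟨h1, h2⟩ := Complex.le_def.1 (Set.mem_Ici.1 hc)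
    exact ⟨c.re, h1, Complex.ext rfl h2⟩
  · exact h.lift ℝ

open scoped ComplexOrder in
theorem polynormableSpace_complex [IsTopologicalAddGroup E] [ContinuousSMul ℂ E]
    [LocallyConvexSpace ℝ E] : PolynormableSpace ℂ E := by
  have : LocallyConvexSpace ℂ E := locallyConvexSpace_complex
  have : ContinuousSMul ℝ E := IsScalarTower.continuousSMul ℂ
  exact LocallyConvexSpace.toPolynormableSpace

/-- Hahn–Banach for `c • x ↦ c * p x` on the line through `x`; it reduces seminorm estimates to
scalar contour integrals. -/
theorem exists_strongDual_apply_eq_seminorm [PolynormableSpace ℂ E] {p : Seminorm ℂ E}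
    (hp : Continuous p) (x : E) :
    ∃ φ : StrongDual ℂ E, φ x = p x ∧ ∀ y, ‖φ y‖ ≤ p y := by
  by_cases hx : x = 0
  · exact ⟨0, by simp [hx], fun y => by simp⟩
  · obtain ⟨φ, h1, h2⟩ := Module.Dual.exists_continuous_extension_of_le_seminorm
      (Submodule.span ℂ {x}) ((p x : ℂ) • (LinearEquiv.coord ℂ E x hx : _ →ₗ[ℂ] ℂ)) hp (by
        rintro ⟨y, hy⟩
        obtain ⟨c, rfl⟩ := Submodule.mem_span_singleton.1 hy
        have : LinearEquiv.coord ℂ E x hx ⟨c • x, hy⟩ = c := by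
          have := LinearEquiv.coord_apply_smul ℂ E x hx ⟨c • x, hy⟩
          exact smul_left_injective ℂ hx this
        simp [this, map_smul_eq_mul, abs_of_nonneg (apply_nonneg p x), mul_comm])
    refine ⟨φ, ?_, h2⟩
    have := h1 ⟨x, Submodule.mem_span_singleton_self x⟩
    rw [this]
    simp [LinearEquiv.coord_self]

/-- A series with bounded terms and absolutely summable coefficients converges in a Mackey complete
locally convex space. -/
theorem IsMackeyComplete.exists_tendsto_sum [PolynormableSpace ℂ E] (hM : IsMackeyComplete E)
    {b : ℕ → E} (hb : Bornology.IsVonNBounded ℂ (Set.range b)) {c : ℕ → ℂ}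
    (hc : Summable fun k => ‖c k‖) :
    ∃ s, Tendsto (fun n => ∑ k ∈ Finset.range n, c k • b k) atTop (𝓝 s) := by
  apply hM
  have hP := PolynormableSpace.withSeminorms ℂ E
  have hb' := hP.isVonNBounded_iff_seminorm_bounded.1 hb
  choose M hM0 hM using hb'
  set S : ℕ → ℝ := fun n => ∑ k ∈ Finset.range n, ‖c k‖ with hS
  have hle : ∀ n m, n ≤ m → ∀ p, p.1 (∑ k ∈ Finset.range n, c k • b k -
      ∑ k ∈ Finset.range m, c k • b k) ≤ |S n - S m| * M p := by
    intro n m hnm p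
    rw [map_sub_rev, ← Finset.sum_Ico_eq_sub _ hnm, abs_sub_comm, hS]
    simp only
    rw [← Finset.sum_Ico_eq_sub _ hnm, abs_of_nonneg (Finset.sum_nonneg fun _ _ => norm_nonneg _),
      Finset.sum_mul]
    refine (Finset.le_sum_of_subadditive p.1 (map_zero p.1).le (map_add_le_add _) _ _).trans ?_
    refine Finset.sum_le_sum fun k _ => ?_
    rw [map_smul_eq_mul]
    exact mul_le_mul_of_nonneg_left (hM p _ ⟨k, rfl⟩).le (norm_nonneg _)
  have hle' : ∀ n m p, p.1 (∑ k ∈ Finset.range n, c k • b k -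
      ∑ k ∈ Finset.range m, c k • b k) ≤ |S n - S m| * M p := by
    intro n m p
    rcases le_total n m with h | h
    · exact hle n m h p
    · rw [map_sub_rev, abs_sub_comm]
      exact hle m n h p
  -- The summand `1 / (n + 1)` keeps the scalar nonzero, so that one can divide by it even when `S n
  -- = S m`.
  refine ⟨{x | ∀ p : {p : Seminorm ℂ E // Continuous p}, p.1 x ≤ M p}, ?_,
    fun q => |S q.1 - S q.2| + 1 / ((q.1 : ℝ) + 1), ?_, fun n m => ?_⟩
  · rw [hP.isVonNBounded_iff_seminorm_bounded]
    exact fun p => ⟨M p + 1, by linarith [hM0 p], fun x hx => by linarith [hx p]⟩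
  · have hSt : Tendsto S atTop (𝓝 (∑' k, ‖c k‖)) := hc.hasSum.tendsto_sum_nat
    rw [← prod_atTop_atTop_eq]
    have h1 := ((hSt.comp tendsto_fst).sub (hSt.comp tendsto_snd) :
      Tendsto _ (atTop ×ˢ atTop) _).abs
    have h2 := (tendsto_one_div_add_atTop_nhds_zero_nat (𝕜 := ℝ)).comp
      (tendsto_fst : Tendsto _ (atTop ×ˢ (atTop : Filter ℕ)) _)
    simpa using h1.add h2
  · have ht : 0 < |S n - S m| + 1 / ((n : ℝ) + 1) := by positivity
    set t := |S n - S m| + 1 / ((n : ℝ) + 1) with htdef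
    refine ⟨((t : ℂ))⁻¹ • (∑ k ∈ Finset.range n, c k • b k - ∑ k ∈ Finset.range m, c k • b k),
      fun p => ?_, ?_⟩
    · rw [map_smul_eq_mul, norm_inv, Complex.norm_real, Real.norm_of_nonneg ht.le,
        inv_mul_le_iff₀ ht]
      refine (hle' n m p).trans (mul_le_mul_of_nonneg_right ?_ (hM0 p).le)
      rw [htdef]
      have : 0 < 1 / ((n : ℝ) + 1) := by positivity
      linarith
    · rw [smul_inv_smul₀]
      exact Complex.ofReal_ne_zero.2 ht.ne'

end LocallyConvex

/-! ### Resolvents and power series in a continuous inverse algebra -/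

section ContinuousInverse

variable {A : Type*} [CommRing A] [Algebra ℂ A] [TopologicalSpace A] [IsContinuousInverseAlgebra A]

namespace IsContinuousInverseAlgebra

theorem eventually_isUnit_one_sub_smul (a : A) {w : ℂ} (hw : IsUnit (1 - w • a)) :
    ∀ᶠ v in 𝓝 w, IsUnit (1 - v • a) := by
  have hc : Continuous fun v : ℂ => 1 - v • a := by fun_prop
  exact (isOpen_units.preimage hc).mem_nhds hw

theorem continuousAt_inverse_one_sub_smul (a : A) {w : ℂ} (hw : IsUnit (1 - w • a)) :
    ContinuousAt (fun v : ℂ => Ring.inverse (1 - v • a)) w := by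
  have hc : Continuous fun v : ℂ => 1 - v • a := by fun_prop
  have h1 : ContinuousAt (Ring.inverse : A → A) (1 - w • a) :=
    continuousOn_inverse.continuousAt (isOpen_units.mem_nhds hw)
  exact ContinuousAt.comp (f := fun v : ℂ => 1 - v • a) h1 hc.continuousAt

theorem inverse_one_sub_smul_sub {A : Type*} [CommRing A] [Algebra ℂ A] (a : A) {v w : ℂ}
    (hv : IsUnit (1 - v • a)) (hw : IsUnit (1 - w • a)) :
    Ring.inverse (1 - v • a) - Ring.inverse (1 - w • a) =
      (v - w) • (a * Ring.inverse (1 - v • a) * Ring.inverse (1 - w • a)) := by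
  have h1 := Ring.mul_inverse_cancel _ hv
  have h2 := Ring.mul_inverse_cancel _ hw
  set y := Ring.inverse (1 - v • a)
  set x := Ring.inverse (1 - w • a)
  simp only [Algebra.smul_def, map_sub] at *
  linear_combination x * h1 - y * h2

/-- The resolvent identity turns the difference quotient into an expression continuous in `v`. The
factor `b` makes room for the powers of `a` in Cauchy's formula. -/
theorem differentiableAt_apply_mul_inverse (φ : StrongDual ℂ A) (a b : A) {w : ℂ}
    (hw : IsUnit (1 - w • a)) :
    DifferentiableAt ℂ (fun v : ℂ => φ (b * Ring.inverse (1 - v • a))) w := by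
  suffices h : HasDerivAt (fun v : ℂ => φ (b * Ring.inverse (1 - v • a)))
      (φ (b * (a * Ring.inverse (1 - w • a) * Ring.inverse (1 - w • a)))) w from h.differentiableAt
  rw [hasDerivAt_iff_tendsto_slope]
  have hc := continuousAt_inverse_one_sub_smul a hw
  have h1 : ContinuousAt (fun v : ℂ => φ (b * (a * Ring.inverse (1 - v • a) *
      Ring.inverse (1 - w • a)))) w := by
    refine φ.continuous.continuousAt.comp ?_
    exact continuousAt_const.mul ((continuousAt_const.mul hc).mul continuousAt_const)
  refine Tendsto.congr' ?_ (h1.tendsto.mono_left nhdsWithin_le_nhds)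
  filter_upwards [nhdsWithin_le_nhds (eventually_isUnit_one_sub_smul a hw),
    self_mem_nhdsWithin] with v hv hne
  rw [slope_def_module, ← map_sub, ← mul_sub, inverse_one_sub_smul_sub a hv hw, mul_smul_comm,
    map_smul, smul_smul, inv_mul_cancel₀ (sub_ne_zero.2 hne), one_smul]

/-- The Taylor coefficients at `0` of the resolvent function are given by Cauchy's formula. -/
theorem circleIntegral_zpow_mul_apply (φ : StrongDual ℂ A) (a : A)
    (hu : ∀ w : ℂ, ‖w‖ ≤ 1 → IsUnit (1 - w • a)) (k n : ℕ) :
    (∮ w in C(0, 1), w ^ (-(k + 1) : ℤ) * φ (a ^ n * Ring.inverse (1 - w • a))) =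
      2 * Real.pi * Complex.I * φ (a ^ (n + k)) := by
  induction k generalizing n with
  | zero =>
    have h := Complex.circleIntegral_sub_center_inv_smul_of_differentiable_on_off_countable
      (R := 1) (c := 0) (f := fun w : ℂ => φ (a ^ n * Ring.inverse (1 - w • a))) one_pos
      Set.countable_empty
      (fun w hw => (differentiableAt_apply_mul_inverse φ a _
        (hu w (by simpa using hw))).continuousAt.continuousWithinAt)
      (fun w hw => differentiableAt_apply_mul_inverse φ a _
        (hu w (by simpa using (Metric.ball_subset_closedBall hw.1))))
    simpa using h
  | succ k ih =>
    -- Expanding `a ^ n (1 - w a)⁻¹ = a ^ n + w a ^ (n + 1) (1 - w a)⁻¹` trades a power of `w` for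
    -- one of `a`; the first term integrates to `0` because its exponent `-(k + 2)` is not `-1`.
    rw [show n + (k + 1) = (n + 1) + k by ring, ← ih (n + 1)]
    have hne : ∀ w ∈ Metric.sphere (0 : ℂ) 1, w ≠ 0 := fun w hw h => by simp [h] at hw
    have e : Set.EqOn
        (fun w : ℂ => w ^ (-((k + 1 : ℕ) + 1) : ℤ) * φ (a ^ n * Ring.inverse (1 - w • a)))
        (fun w : ℂ => φ (a ^ n) * w ^ (-((k + 1 : ℕ) + 1) : ℤ) +
          w ^ (-(k + 1) : ℤ) * φ (a ^ (n + 1) * Ring.inverse (1 - w • a)))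
        (Metric.sphere 0 1) := by
      intro w hw
      have hw0 := hne w hw
      have h1 := Ring.mul_inverse_cancel _ (hu w (by simpa using hw.le))
      have h2 : a ^ n * Ring.inverse (1 - w • a) =
          a ^ n + w • (a ^ (n + 1) * Ring.inverse (1 - w • a)) := by
        simp only [Algebra.smul_def] at *
        linear_combination a ^ n * h1
      have h3 : w ^ (-(k + 1) : ℤ) = w ^ (-((k + 1 : ℕ) + 1) : ℤ) * w := by
        rw [← zpow_add_one₀ hw0]
        congr 1
      simp only
      rw [h3, h2, map_add, map_smul, smul_eq_mul]
      ring
    have hcz : ∀ j : ℤ, ContinuousOn (fun w : ℂ => w ^ j) (Metric.sphere 0 1) := fun j w hw =>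
      (continuousAt_zpow₀ w j (Or.inl (hne w hw))).continuousWithinAt
    have hcφ : ContinuousOn (fun w : ℂ => φ (a ^ (n + 1) * Ring.inverse (1 - w • a)))
        (Metric.sphere 0 1) := fun w hw => (differentiableAt_apply_mul_inverse φ a _
          (hu w (by simpa using hw.le))).continuousAt.continuousWithinAt
    rw [circleIntegral.integral_congr zero_le_one e, circleIntegral.integral_add
      (f := fun w : ℂ => φ (a ^ n) * w ^ (-((k + 1 : ℕ) + 1) : ℤ))
      (g := fun w : ℂ => w ^ (-(k + 1) : ℤ) * φ (a ^ (n + 1) * Ring.inverse (1 - w • a)))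
      ((continuousOn_const.mul (hcz _)).circleIntegrable zero_le_one)
      (((hcz _).mul hcφ).circleIntegrable zero_le_one), circleIntegral.integral_const_mul]
    have := circleIntegral.integral_sub_zpow_of_ne (n := -((k + 1 : ℕ) + 1))
      (by push_cast; omega) 0 0 1
    simp only [sub_zero] at this
    rw [this, mul_zero, zero_add]

/-- Cauchy's estimate on the unit circle, for a functional norming `a ^ n`. The bound does not
depend on `n`. -/
theorem seminorm_pow_le {p : Seminorm ℂ A} (hp : Continuous p) (a : A)
    (hu : ∀ w : ℂ, ‖w‖ ≤ 1 → IsUnit (1 - w • a)) {M : ℝ}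
    (hM : ∀ w : ℂ, ‖w‖ = 1 → p (Ring.inverse (1 - w • a)) ≤ M) (n : ℕ) : p (a ^ n) ≤ M := by
  have : PolynormableSpace ℂ A := polynormableSpace_complex
  obtain ⟨φ, h1, h2⟩ := exists_strongDual_apply_eq_seminorm hp (a ^ n)
  have h := circleIntegral_zpow_mul_apply φ a hu n 0
  simp only [pow_zero, one_mul, zero_add] at h
  have hle := circleIntegral.norm_integral_le_of_norm_le_const (c := 0) (R := 1) (C := M)
    (f := fun w : ℂ => w ^ (-(n + 1) : ℤ) * φ (Ring.inverse (1 - w • a))) zero_le_one (by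
      intro w hw
      have hw : ‖w‖ = 1 := by simpa using hw
      rw [norm_mul, norm_zpow, hw, one_zpow, one_mul]
      exact (h2 _).trans (hM w hw))
  rw [h, h1, norm_mul, Complex.norm_real, Real.norm_of_nonneg (apply_nonneg p _)] at hle
  have h2pi : ‖(2 * Real.pi * Complex.I : ℂ)‖ = 2 * Real.pi := by
    simp [abs_of_pos Real.pi_pos]
  rw [h2pi, mul_one] at hle
  exact le_of_mul_le_mul_left hle Real.two_pi_pos

theorem isVonNBounded_range_pow (a : A) (hu : ∀ w : ℂ, ‖w‖ ≤ 1 → IsUnit (1 - w • a)) :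
    Bornology.IsVonNBounded ℂ (Set.range fun n : ℕ => a ^ n) := by
  have : PolynormableSpace ℂ A := polynormableSpace_complex
  rw [(PolynormableSpace.withSeminorms ℂ A).isVonNBounded_iff_seminorm_bounded]
  rintro ⟨p, hp⟩
  obtain ⟨M, hM⟩ := (isCompact_sphere (0 : ℂ) 1).bddAbove_image
    (f := fun w : ℂ => p (Ring.inverse (1 - w • a))) (fun w hw =>
      (hp.continuousAt.comp (continuousAt_inverse_one_sub_smul a
        (hu w (by simpa using hw.le)))).continuousWithinAt)
  have hb := seminorm_pow_le hp a hu (M := M) fun w hw => hM ⟨w, by simpa using hw, rfl⟩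
  refine ⟨|M| + 1, by positivity, ?_⟩
  rintro _ ⟨n, rfl⟩
  linarith [hb n, le_abs_self M]

/-- A power series converges at `a` if its radius of convergence exceeds the spectral radius
of `a`. -/
theorem exists_tendsto_powerSeries (hM : IsMackeyComplete A) (a : A) {R : ℝ} (hR : 0 < R)
    (hu : ∀ w : ℂ, ‖w‖ ≤ R → IsUnit (1 - w • a)) {c : ℕ → ℂ}
    (hc : Summable fun k => ‖c k‖ / R ^ k) :
    ∃ s, Tendsto (fun n => ∑ k ∈ Finset.range n, c k • a ^ k) atTop (𝓝 s) := by
  have : PolynormableSpace ℂ A := polynormableSpace_complex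
  -- Rescaling by `R` moves the disc of radius `R` to the unit disc and `c k` to `c k / R ^ k`.
  have hb := isVonNBounded_range_pow ((R : ℂ) • a) fun w hw => by
    rw [smul_smul]
    refine hu _ ?_
    rw [norm_mul, Complex.norm_real, Real.norm_of_nonneg hR.le]
    exact mul_le_of_le_one_left hR.le hw
  obtain ⟨s, hs⟩ := hM.exists_tendsto_sum hb (c := fun k => c k / (R : ℂ) ^ k) (by
    simpa [abs_of_pos hR] using hc)
  refine ⟨s, hs.congr fun n => Finset.sum_congr rfl fun k _ => ?_⟩
  have : (R : ℂ) ^ k ≠ 0 := pow_ne_zero _ (by exact_mod_cast hR.ne')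
  rw [smul_pow, smul_smul, div_mul_cancel₀ _ this]

theorem exists_isUnit_one_sub_smul (a : A) :
    ∃ R : ℝ, 0 < R ∧ ∀ w : ℂ, ‖w‖ ≤ R → IsUnit (1 - w • a) := by
  have h := eventually_isUnit_one_sub_smul a (w := 0) (by simp)
  obtain ⟨R, hR, h⟩ := Metric.nhds_basis_closedBall.eventually_iff.1 h
  exact ⟨R, hR, fun w hw => h (by simpa using hw)⟩

end IsContinuousInverseAlgebra

end ContinuousInverse

/-! ### The two subalgebras and products of factorizations -/

section RCia

open IsContinuousInverseAlgebra

theorem circleZPow_apply (n : ℤ) (z : Circle) : circleZPow n z = (z : ℂ) ^ n := by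
  simp [circleZPow]

theorem circleZPow_zero : circleZPow 0 = 1 := by
  ext z
  simp [circleZPow_apply]

theorem circleZPow_add (m n : ℤ) : circleZPow (m + n) = circleZPow m * circleZPow n := by
  ext z
  simp [circleZPow_apply, zpow_add₀]

variable {A : Type*} [CommRing A] [Algebra ℂ A] [TopologicalSpace A] [IsContinuousInverseAlgebra A]

/-- Every unital algebra homomorphism from a continuous inverse algebra to `C(𝕊, ℂ)` is
continuous. -/
theorem AlgHom.continuous_of_isContinuousInverseAlgebra (ι : A →ₐ[ℂ] C(Circle, ℂ)) :
    Continuous ι := by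
  have hc : Continuous fun a : A => 1 - a := by fun_prop
  have hU : {a : A | IsUnit (1 - a)} ∈ 𝓝 (0 : A) :=
    (isOpen_units.preimage hc).mem_nhds (by simp)
  obtain ⟨V, ⟨hV, hVb⟩, hVU⟩ := (nhds_basis_balanced ℂ A).mem_iff.1 hU
  have hle : ∀ a ∈ V, ‖ι a‖ ≤ 1 := by
    intro a ha
    rw [ContinuousMap.norm_le _ zero_le_one]
    intro z
    -- Otherwise `(ι a z)⁻¹ • a` still lies in the balanced set `V`, so `1` minus it is a unit, yet
    -- it vanishes at `z`.
    by_contra! hlt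
    have h0 : ι a z ≠ 0 := fun h => by simp [h] at hlt; linarith
    have hmem : (ι a z)⁻¹ • a ∈ V := hVb.smul_mem (by
      rw [norm_inv]
      exact inv_le_one_of_one_le₀ hlt.le) ha
    have hu := ((hVU hmem).map ι).map (ContinuousMap.evalAlgHom ℂ ℂ z)
    simp [h0] at hu
  refine continuous_of_continuousAt_zero ι ?_
  rw [ContinuousAt, map_zero, Metric.nhds_basis_closedBall.tendsto_right_iff]
  intro ε hε
  have hε' : (ε : ℂ) ≠ 0 := by exact_mod_cast hε.ne'
  filter_upwards [(set_smul_mem_nhds_zero_iff hε').2 hV] with a ha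
  obtain ⟨b, hb, rfl⟩ := ha
  simp only [mem_closedBall_zero_iff, map_smul, norm_smul, Complex.norm_real,
    Real.norm_of_nonneg hε.le]
  exact mul_le_of_le_one_right hε.le (hle b hb)

variable (ι : A →ₐ[ℂ] C(Circle, ℂ))

/-- Evaluation at `z` after `ι` is a continuous character, so scalar power series determine the
limit. -/
theorem hasSum_apply_of_tendsto_powerSeries {a s : A} {c : ℕ → ℂ}
    (hs : Tendsto (fun n => ∑ k ∈ Finset.range n, c k • a ^ k) atTop (𝓝 s)) {z : Circle} {y : ℂ}
    (hy : HasSum (fun k => c k * (ι a z) ^ k) y) : ι s z = y := by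
  have hc : Continuous fun b : A => ι b z :=
    (continuous_eval_const z).comp ι.continuous_of_isContinuousInverseAlgebra
  refine tendsto_nhds_unique ((hc.tendsto s).comp hs) (hy.tendsto_sum_nat.congr fun n => ?_)
  simp

theorem span_circleZPow_mul_mem {S : Set ℤ} (hS : ∀ m ∈ S, ∀ n ∈ S, m + n ∈ S)
    {f g : C(Circle, ℂ)} (hf : f ∈ Submodule.span ℂ (circleZPow '' S))
    (hg : g ∈ Submodule.span ℂ (circleZPow '' S)) :
    f * g ∈ Submodule.span ℂ (circleZPow '' S) := by
  have h := Submodule.mul_mem_mul hf hg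
  rw [Submodule.span_mul_span] at h
  refine Submodule.span_mono ?_ h
  rintro _ ⟨_, ⟨m, hm, rfl⟩, _, ⟨n, hn, rfl⟩, rfl⟩
  exact ⟨m + n, hS m hm n hn, circleZPow_add m n⟩

theorem topologicalClosure_comap_mul_mem {S : Submodule ℂ C(Circle, ℂ)}
    (hS : ∀ f ∈ S, ∀ g ∈ S, f * g ∈ S) {a b : A}
    (ha : a ∈ (S.comap ι.toLinearMap).topologicalClosure)
    (hb : b ∈ (S.comap ι.toLinearMap).topologicalClosure) :
    a * b ∈ (S.comap ι.toLinearMap).topologicalClosure :=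
  map_mem_closure₂ continuous_mul ha hb fun x hx y hy => by
    simpa using hS _ hx _ hy

variable {ι}

theorem plusPart_mul_mem {a b : A} (ha : a ∈ plusPart ι) (hb : b ∈ plusPart ι) :
    a * b ∈ plusPart ι :=
  topologicalClosure_comap_mul_mem ι (fun _ hf _ hg =>
    span_circleZPow_mul_mem (fun m (hm : 0 ≤ m) n (hn : 0 ≤ n) => (by omega : 0 ≤ m + n)) hf hg)
    ha hb

theorem ominusPart_mul_mem {a b : A} (ha : a ∈ ominusPart ι) (hb : b ∈ ominusPart ι) :
    a * b ∈ ominusPart ι :=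
  topologicalClosure_comap_mul_mem ι (fun _ hf _ hg =>
    span_circleZPow_mul_mem (fun m (hm : m < 0) n (hn : n < 0) => (by omega : m + n < 0)) hf hg)
    ha hb

theorem mem_plusPart_of_eq_circleZPow {a : A} {n : ℤ} (hn : 0 ≤ n) (h : ι a = circleZPow n) :
    a ∈ plusPart ι :=
  Submodule.le_topologicalClosure _ (Submodule.subset_span ⟨n, hn, h.symm⟩)

theorem mem_ominusPart_of_eq_circleZPow {a : A} {n : ℤ} (hn : n < 0) (h : ι a = circleZPow n) :
    a ∈ ominusPart ι :=
  Submodule.le_topologicalClosure _ (Submodule.subset_span ⟨n, hn, h.symm⟩)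

theorem one_mem_plusPart : (1 : A) ∈ plusPart ι :=
  mem_plusPart_of_eq_circleZPow le_rfl (by rw [map_one, circleZPow_zero])

theorem mem_minusPart_iff {a : A} :
    a ∈ minusPart ι ↔ ∃ c : ℂ, a - c • (1 : A) ∈ ominusPart ι := by
  rw [minusPart, Submodule.mem_sup]
  constructor
  · rintro ⟨x, hx, y, hy, rfl⟩
    obtain ⟨c, rfl⟩ := Submodule.mem_span_singleton.1 hx
    exact ⟨c, by simpa using hy⟩
  · rintro ⟨c, hc⟩
    exact ⟨c • 1, Submodule.smul_mem _ _ (Submodule.mem_span_singleton_self _), _, hc, by simp⟩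

theorem one_mem_minusPart : (1 : A) ∈ minusPart ι :=
  mem_minusPart_iff.2 ⟨1, by simp⟩

theorem ominusPart_le_minusPart : ominusPart ι ≤ minusPart ι := le_sup_right

theorem minusPart_mul_mem {a b : A} (ha : a ∈ minusPart ι) (hb : b ∈ minusPart ι) :
    a * b ∈ minusPart ι := by
  obtain ⟨c, hc⟩ := mem_minusPart_iff.1 ha
  obtain ⟨d, hd⟩ := mem_minusPart_iff.1 hb
  refine mem_minusPart_iff.2 ⟨c * d, ?_⟩
  have := (ominusPart ι).add_mem (ominusPart_mul_mem hc hd)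
    ((ominusPart ι).add_mem ((ominusPart ι).smul_mem d hc) ((ominusPart ι).smul_mem c hd))
  convert this using 1
  simp only [Algebra.smul_def, map_mul]
  ring

theorem plusPart_pow_mem {a : A} (ha : a ∈ plusPart ι) (k : ℕ) : a ^ k ∈ plusPart ι := by
  induction k with
  | zero => simpa using one_mem_plusPart
  | succ k ih => exact pow_succ a k ▸ plusPart_mul_mem ih ha

theorem ominusPart_pow_succ_mem {a : A} (ha : a ∈ ominusPart ι) (k : ℕ) :
    a ^ (k + 1) ∈ ominusPart ι := by
  induction k with
  | zero => simpa using ha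
  | succ k ih => exact pow_succ a (k + 1) ▸ ominusPart_mul_mem ih ha

theorem plusPart_powerSeries_mem {a s : A} {c : ℕ → ℂ} (ha : a ∈ plusPart ι)
    (hs : Tendsto (fun n => ∑ k ∈ Finset.range n, c k • a ^ k) atTop (𝓝 s)) : s ∈ plusPart ι :=
  (Submodule.isClosed_topologicalClosure _).mem_of_tendsto hs (Eventually.of_forall fun _ =>
    (plusPart ι).sum_mem fun k _ => (plusPart ι).smul_mem _ (plusPart_pow_mem ha k))

/-- Removing the constant term leaves a limit inside `ominusPart`, which is closed by construction.
-/
theorem minusPart_powerSeries_mem {a s : A} {c : ℕ → ℂ} (ha : a ∈ ominusPart ι)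
    (hs : Tendsto (fun n => ∑ k ∈ Finset.range n, c k • a ^ k) atTop (𝓝 s)) :
    s ∈ minusPart ι := by
  refine mem_minusPart_iff.2 ⟨c 0, ?_⟩
  have h := ((tendsto_add_atTop_iff_nat 1).2 hs).sub_const (c 0 • (1 : A))
  refine (Submodule.isClosed_topologicalClosure _).mem_of_tendsto h
    (Eventually.of_forall fun n => ?_)
  rw [Finset.sum_range_succ', pow_zero, add_sub_cancel_right]
  exact (ominusPart ι).sum_mem fun k _ => (ominusPart ι).smul_mem _ (ominusPart_pow_succ_mem ha k)

theorem IsUnitIn.mul {A : Type*} [CommRing A] [Algebra ℂ A] {S : Submodule ℂ A}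
    (hS : ∀ {a b : A}, a ∈ S → b ∈ S → a * b ∈ S) {a b : A}
    (ha : IsUnitIn S a) (hb : IsUnitIn S b) : IsUnitIn S (a * b) := by
  obtain ⟨ha, a', ha', haa⟩ := ha
  obtain ⟨hb, b', hb', hbb⟩ := hb
  exact ⟨hS ha hb, a' * b', hS ha' hb', by linear_combination b * b' * haa + hbb⟩

/-- `a` has a Wiener-Hopf factorization `a = a₊ z ^ κ a₋`. -/
def HasFactorization (ι : A →ₐ[ℂ] C(Circle, ℂ)) (a : A) : Prop :=
  ∃ (ap am : A) (κ : ℤ), IsUnitIn (plusPart ι) ap ∧ IsUnitIn (minusPart ι) am ∧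
    ι a = ι ap * circleZPow κ * ι am

namespace HasFactorization

theorem mul {a b : A} (ha : HasFactorization ι a) (hb : HasFactorization ι b) :
    HasFactorization ι (a * b) := by
  obtain ⟨ap, am, m, hap, ham, ha⟩ := ha
  obtain ⟨bp, bm, n, hbp, hbm, hb⟩ := hb
  refine ⟨ap * bp, am * bm, m + n, hap.mul plusPart_mul_mem hbp, ham.mul minusPart_mul_mem hbm, ?_⟩
  rw [map_mul, map_mul, map_mul, ha, hb, circleZPow_add]
  ring

theorem inv {a b : A} (ha : HasFactorization ι a) (hab : a * b = 1) : HasFactorization ι b := by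
  obtain ⟨ap, am, m, ⟨hap, ap', hap', hp⟩, ⟨ham, am', ham', hm⟩, ha⟩ := ha
  refine ⟨ap', am', -m, ⟨hap', ap, hap, mul_comm ap' ap ▸ hp⟩,
    ⟨ham', am, ham, mul_comm am' am ▸ hm⟩, ?_⟩
  have h1 : ι a * ι b = 1 := by rw [← map_mul, hab, map_one]
  have h2 : ι ap * ι ap' = 1 := by rw [← map_mul, hp, map_one]
  have h3 : ι am * ι am' = 1 := by rw [← map_mul, hm, map_one]
  have h4 : circleZPow m * circleZPow (-m) = 1 := by
    rw [← circleZPow_add, add_neg_cancel, circleZPow_zero]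
  rw [ha] at h1
  calc ι b = ι b * (ι ap * ι ap') * (ι am * ι am') * (circleZPow m * circleZPow (-m)) := by
        rw [h2, h3, h4]; ring
    _ = (ι ap * circleZPow m * ι am * ι b) * (ι ap' * circleZPow (-m) * ι am') := by ring
    _ = _ := by rw [h1, one_mul]

theorem of_isUnitIn_plusPart {a : A} (ha : IsUnitIn (plusPart ι) a) : HasFactorization ι a :=
  ⟨a, 1, 0, ha, ⟨one_mem_minusPart, 1, one_mem_minusPart, mul_one 1⟩, by simp [circleZPow_zero]⟩

theorem of_isUnitIn_minusPart {a : A} (ha : IsUnitIn (minusPart ι) a) : HasFactorization ι a :=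
  ⟨1, a, 0, ⟨one_mem_plusPart, 1, one_mem_plusPart, mul_one 1⟩, ha, by simp [circleZPow_zero]⟩

theorem of_eq_circleZPow {a : A} {n : ℤ} (h : ι a = circleZPow n) : HasFactorization ι a :=
  ⟨1, 1, n, ⟨one_mem_plusPart, 1, one_mem_plusPart, mul_one 1⟩,
    ⟨one_mem_minusPart, 1, one_mem_minusPart, mul_one 1⟩, by simp [h]⟩

end HasFactorization

end RCia

/-! ### Existence of the factorization -/

section Factorization

open IsContinuousInverseAlgebra

variable {A : Type*} [CommRing A] [Algebra ℂ A] [TopologicalSpace A] [IsContinuousInverseAlgebra A]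
  {ι : A →ₐ[ℂ] C(Circle, ℂ)}

theorem apply_ne_zero_of_isUnit {A : Type*} [CommRing A] [Algebra ℂ A] (ι : A →ₐ[ℂ] C(Circle, ℂ))
    {a : A} (ha : IsUnit a) (z : Circle) : ι a z ≠ 0 :=
  ((ha.map ι).map (ContinuousMap.evalAlgHom ℂ ℂ z)).ne_zero

/-- Otherwise `w = (ι a z)⁻¹` is admissible, and `1 - w • a` vanishes at `z`. -/
theorem norm_apply_mul_lt_one {A : Type*} [CommRing A] [Algebra ℂ A] (ι : A →ₐ[ℂ] C(Circle, ℂ))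
    {a : A} {R : ℝ} (hu : ∀ w : ℂ, ‖w‖ ≤ R → IsUnit (1 - w • a)) (z : Circle) :
    R * ‖ι a z‖ < 1 := by
  by_contra! h
  have h0 : ι a z ≠ 0 := fun h0 => by simp [h0] at h; linarith
  have hpos := norm_pos_iff.2 h0
  refine apply_ne_zero_of_isUnit ι (hu (ι a z)⁻¹ ?_) z ?_
  · rw [norm_inv]
    exact (inv_le_iff_one_le_mul₀ hpos).2 h
  · simp [h0]

/-- The series exhibits the inverse as a limit of polynomials in `a`, which places it in `A⁺` or
`A⁻` along with `a`. -/
theorem IsRCia.exists_neumann (hR : IsRCia ι) (hM : IsMackeyComplete A) {a : A} {R : ℝ}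
    (hR1 : 1 < R) (hu : ∀ w : ℂ, ‖w‖ ≤ R → IsUnit (1 - w • a)) :
    ∃ s, Tendsto (fun n => ∑ k ∈ Finset.range n, (1 : ℂ) • a ^ k) atTop (𝓝 s) ∧
      (1 - a) * s = 1 := by
  have hR0 : 0 < R := one_pos.trans hR1
  obtain ⟨s, hs⟩ := exists_tendsto_powerSeries hM a hR0 hu (c := fun _ => 1) (by
    simpa using summable_geometric_of_lt_one (inv_nonneg.2 hR0.le) (inv_lt_one_of_one_lt₀ hR1))
  refine ⟨s, hs, hR.injective ?_⟩
  ext z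
  have hlt : ‖ι a z‖ < 1 := by
    nlinarith [norm_apply_mul_lt_one ι hu z, norm_nonneg (ι a z)]
  have hne : 1 - ι a z ≠ 0 := by
    simpa using apply_ne_zero_of_isUnit ι (hu 1 (by simpa using hR1.le)) z
  have h := hasSum_apply_of_tendsto_powerSeries ι hs (z := z) (y := (1 - ι a z)⁻¹)
    (by simpa using hasSum_geometric_of_norm_lt_one hlt)
  simp [h, hne]

theorem IsRCia.isUnitIn_plusPart_one_sub (hR : IsRCia ι) (hM : IsMackeyComplete A) {a : A}
    (ha : a ∈ plusPart ι) {R : ℝ} (hR1 : 1 < R) (hu : ∀ w : ℂ, ‖w‖ ≤ R → IsUnit (1 - w • a)) :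
    IsUnitIn (plusPart ι) (1 - a) :=
  have ⟨s, hs, h⟩ := hR.exists_neumann hM hR1 hu
  ⟨sub_mem one_mem_plusPart ha, s, plusPart_powerSeries_mem ha hs, h⟩

theorem IsRCia.isUnitIn_minusPart_one_sub (hR : IsRCia ι) (hM : IsMackeyComplete A) {a : A}
    (ha : a ∈ ominusPart ι) {R : ℝ} (hR1 : 1 < R) (hu : ∀ w : ℂ, ‖w‖ ≤ R → IsUnit (1 - w • a)) :
    IsUnitIn (minusPart ι) (1 - a) :=
  have ⟨s, hs, h⟩ := hR.exists_neumann hM hR1 hu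
  ⟨sub_mem one_mem_minusPart (ominusPart_le_minusPart ha), s, minusPart_powerSeries_mem ha hs, h⟩

/-- The exponential series is entire, so any positive `R` will do. -/
theorem exists_exp (ι : A →ₐ[ℂ] C(Circle, ℂ)) (hM : IsMackeyComplete A) (u : A) :
    ∃ e, Tendsto (fun n => ∑ k ∈ Finset.range n, ((k.factorial : ℂ)⁻¹) • u ^ k) atTop (𝓝 e) ∧
      ∀ z, ι e z = Complex.exp (ι u z) := by
  obtain ⟨R, hR, hu⟩ := exists_isUnit_one_sub_smul u
  obtain ⟨e, he⟩ := exists_tendsto_powerSeries hM u hR hu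
    (c := fun k => ((k.factorial : ℂ)⁻¹)) (by
    refine (Real.summable_pow_div_factorial R⁻¹).congr fun k => ?_
    simp [div_eq_mul_inv, mul_comm])
  refine ⟨e, he, fun z => hasSum_apply_of_tendsto_powerSeries ι he ?_⟩
  rw [Complex.exp_eq_exp_ℂ]
  simpa [div_eq_mul_inv, mul_comm] using NormedSpace.expSeries_div_hasSum_exp (ι u z)

theorem exists_log (ι : A →ₐ[ℂ] C(Circle, ℂ)) (hM : IsMackeyComplete A) {x : A}
    (hu : ∀ w : ℂ, ‖w‖ ≤ 2 → IsUnit (1 - w • x)) :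
    ∃ u, ∀ z, Complex.exp (ι u z) = 1 + ι x z := by
  -- For `R = 2` the coefficients are dominated by `2⁻ᵏ`; the term `k = 0` is zero, being a division
  -- by `0`.
  obtain ⟨u, hs⟩ := exists_tendsto_powerSeries hM x two_pos hu
    (c := fun k => (-1) ^ (k + 1) / (k : ℂ)) (by
    refine Summable.of_nonneg_of_le (fun k => by positivity) (fun k => ?_)
      summable_geometric_two
    rw [norm_div, norm_pow, norm_neg, norm_one, one_pow, Complex.norm_natCast, one_div_pow]
    refine div_le_div_of_nonneg_right ?_ (by positivity)
    rcases k.eq_zero_or_pos with rfl | hk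
    · simp
    · rw [div_le_one (by exact_mod_cast hk)]
      exact_mod_cast hk)
  refine ⟨u, fun z => ?_⟩
  have hlt : ‖ι x z‖ < 1 := by
    linarith [norm_apply_mul_lt_one ι hu z, norm_nonneg (ι x z)]
  rw [hasSum_apply_of_tendsto_powerSeries ι hs (z := z) (y := Complex.log (1 + ι x z)),
    Complex.exp_log]
  · intro h
    rw [← neg_eq_iff_add_eq_zero] at h
    rw [← h] at hlt
    simp at hlt
  · refine (Complex.hasSum_taylorSeries_log hlt).congr_fun fun k => ?_
    ring

/-- If `u = v + w` with `v ∈ A⁺` and `w ∈ A^⊖`, then `exp u` has the factorization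
`exp v * exp w`. -/
theorem IsRCia.hasFactorization_of_exp (hR : IsRCia ι) (hdec : IsDecomposing ι)
    (hM : IsMackeyComplete A) {h u : A} (hu : ∀ z, Complex.exp (ι u z) = ι h z) :
    HasFactorization ι h := by
  have htop : u ∈ plusPart ι ⊔ ominusPart ι := by
    rw [hdec.isCompl.sup_eq_top]
    trivial
  obtain ⟨v, hv, w, hw, rfl⟩ := Submodule.mem_sup.1 htop
  have key : ∀ {v e e' : A}, (∀ z, ι e z = Complex.exp (ι v z)) →
      (∀ z, ι e' z = Complex.exp (ι (-v) z)) → e * e' = 1 := by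
    intro v e e' h1 h2
    apply hR.injective
    ext z
    simp [h1, h2, ← Complex.exp_add]
  obtain ⟨e, he, hez⟩ := exists_exp ι hM v
  obtain ⟨e', he', hez'⟩ := exists_exp ι hM (-v)
  obtain ⟨f, hf, hfz⟩ := exists_exp ι hM w
  obtain ⟨f', hf', hfz'⟩ := exists_exp ι hM (-w)
  have hhef : h = e * f := by
    apply hR.injective
    ext z
    simp [← hu, hez, hfz, Complex.exp_add]
  rw [hhef]
  refine .mul (.of_isUnitIn_plusPart ⟨plusPart_powerSeries_mem hv he, e', ?_, key hez hez'⟩)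
    (.of_isUnitIn_minusPart ⟨minusPart_powerSeries_mem hw hf, f', ?_, key hfz hfz'⟩)
  · exact plusPart_powerSeries_mem (neg_mem hv) he'
  · exact minusPart_powerSeries_mem (neg_mem hw) hf'

theorem IsRCia.exists_eq_circleZPow_one {A : Type*} [CommRing A] [Algebra ℂ A]
    [TopologicalSpace A] {ι : A →ₐ[ℂ] C(Circle, ℂ)} (hR : IsRCia ι) : ∃ Z, ι Z = circleZPow 1 :=
  hR.rational_subset ⟨Polynomial.X, 1, by simp, by simp [circleZPow_apply]⟩

theorem IsRCia.exists_eq_circleZPow_neg_one {A : Type*} [CommRing A] [Algebra ℂ A]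
    [TopologicalSpace A] {ι : A →ₐ[ℂ] C(Circle, ℂ)} (hR : IsRCia ι) : ∃ Z, ι Z = circleZPow (-1) :=
  hR.rational_subset ⟨1, Polynomial.X, by simp, by simp [circleZPow_apply]⟩

theorem apply_aeval {A : Type*} [CommRing A] [Algebra ℂ A] {ι : A →ₐ[ℂ] C(Circle, ℂ)}
    {Z : A} (hZ : ι Z = circleZPow 1) (p : Polynomial ℂ) (z : Circle) :
    ι (Polynomial.aeval Z p) z = p.eval (z : ℂ) := by
  have := Polynomial.aeval_algHom_apply ((ContinuousMap.evalAlgHom ℂ ℂ z).comp ι) Z p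
  simpa [hZ, circleZPow_apply, Polynomial.coe_aeval_eq_eval] using this.symm

theorem IsRCia.exists_aeval_mul_eq_one {A : Type*} [CommRing A] [Algebra ℂ A]
    [TopologicalSpace A] {ι : A →ₐ[ℂ] C(Circle, ℂ)} (hR : IsRCia ι) {Z : A}
    (hZ : ι Z = circleZPow 1) {p : Polynomial ℂ} (hp : ∀ z : Circle, p.eval (z : ℂ) ≠ 0) :
    ∃ b, Polynomial.aeval Z p * b = 1 := by
  have hc : Continuous fun z : Circle => (p.eval (z : ℂ))⁻¹ :=
    (p.continuous.comp continuous_subtype_val).inv₀ hp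
  obtain ⟨b, hb⟩ := hR.rational_subset (a := ⟨_, hc⟩) ⟨1, p, hp, fun z => by simp⟩
  refine ⟨b, hR.injective ?_⟩
  ext z
  simp [apply_aeval hZ, hb, hp z]

theorem hasFactorization_algebraMap {a : ℂ} (ha : a ≠ 0) :
    HasFactorization ι (algebraMap ℂ A a) := by
  have hmem : ∀ b : ℂ, algebraMap ℂ A b ∈ plusPart ι := fun b => by
    rw [Algebra.algebraMap_eq_smul_one]
    exact Submodule.smul_mem _ _ one_mem_plusPart
  exact .of_isUnitIn_plusPart ⟨hmem a, algebraMap ℂ A a⁻¹, hmem _,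
    by rw [← map_mul, mul_inv_cancel₀ ha, map_one]⟩

/-- Write `z - a` as `z (1 - a z⁻¹)` if `‖a‖ < 1` and as `-a (1 - a⁻¹ z)` if `‖a‖ > 1`; the bracket
is inverted by a Neumann series. -/
theorem IsRCia.hasFactorization_sub (hR : IsRCia ι) (hM : IsMackeyComplete A) {Z : A}
    (hZ : ι Z = circleZPow 1) {a : ℂ} (ha : ‖a‖ ≠ 1) :
    HasFactorization ι (Z - algebraMap ℂ A a) := by
  have hunit : ∀ w : ℂ, ‖w‖ < 1 → IsUnit (1 - w • Z) ∧ IsUnit (Z - algebraMap ℂ A w) := by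
    intro w hw
    constructor
    · obtain ⟨b, hb⟩ := hR.exists_aeval_mul_eq_one hZ (p := 1 - Polynomial.C w * Polynomial.X)
        (fun z h => by
          have h := congrArg norm (sub_eq_zero.1 (by simpa using h : 1 - w * (z : ℂ) = 0))
          rw [norm_one, norm_mul, Circle.norm_coe, mul_one] at h
          linarith)
      refine IsUnit.of_mul_eq_one b ?_
      simpa [Algebra.smul_def] using hb
    · obtain ⟨b, hb⟩ := hR.exists_aeval_mul_eq_one hZ (p := Polynomial.X - Polynomial.C w)
        (fun z h => by
          have h := congrArg norm (sub_eq_zero.1 (by simpa using h : (z : ℂ) - w = 0))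
          rw [Circle.norm_coe] at h
          linarith)
      refine IsUnit.of_mul_eq_one b ?_
      simpa using hb
  rcases lt_or_gt_of_ne ha with ha | ha
  · obtain ⟨Y, hY⟩ := hR.exists_eq_circleZPow_neg_one
    have hZY : Z * Y = 1 := hR.injective (by
      rw [map_mul, hZ, hY, ← circleZPow_add, map_one, ← circleZPow_zero]; rfl)
    have hYm : a • Y ∈ ominusPart ι :=
      Submodule.smul_mem _ _ (mem_ominusPart_of_eq_circleZPow (by norm_num) hY)
    have hpos : 0 < 1 + ‖a‖ := by positivity
    -- The radius needs `1 < R` and `R * ‖a‖ < 1`; the reciprocal of the mean of `1` and `‖a‖`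
    -- satisfies both, also for `a = 0`.
    have h := hR.isUnitIn_minusPart_one_sub hM hYm (R := 2 / (1 + ‖a‖))
      (by rw [lt_div_iff₀ hpos]; linarith) (fun w hw => by
        have hlt : ‖w * a‖ < 1 := by
          rw [norm_mul]
          rw [le_div_iff₀ hpos] at hw
          nlinarith [norm_nonneg a, norm_nonneg w]
        have e : 1 - w • a • Y = (Z - algebraMap ℂ A (w * a)) * Y := by
          rw [sub_mul, hZY, smul_smul, Algebra.smul_def]
        rw [e]
        exact (hunit _ hlt).2.mul (IsUnit.of_mul_eq_one Z (by rw [mul_comm, hZY])))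
    have e : Z - algebraMap ℂ A a = Z * (1 - a • Y) := by
      rw [Algebra.smul_def]
      linear_combination (algebraMap ℂ A a) * hZY
    rw [e]
    exact .mul (.of_eq_circleZPow hZ) (.of_isUnitIn_minusPart h)
  · have ha0 : a ≠ 0 := norm_pos_iff.1 (one_pos.trans ha)
    have hZp : a⁻¹ • Z ∈ plusPart ι :=
      Submodule.smul_mem _ _ (mem_plusPart_of_eq_circleZPow zero_le_one hZ)
    have h := hR.isUnitIn_plusPart_one_sub hM hZp (R := (1 + ‖a‖) / 2) (by linarith) (fun w hw => by
        rw [smul_smul]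
        refine (hunit _ ?_).1
        rw [norm_mul, norm_inv, ← div_eq_mul_inv, div_lt_one (by linarith)]
        linarith)
    have e : Z - algebraMap ℂ A a = algebraMap ℂ A (-a) * (1 - a⁻¹ • Z) := by
      have h1 : algebraMap ℂ A a * algebraMap ℂ A a⁻¹ = 1 := by
        rw [← map_mul, mul_inv_cancel₀ ha0, map_one]
      rw [Algebra.smul_def, map_neg]
      linear_combination (-Z) * h1
    rw [e]
    exact .mul (hasFactorization_algebraMap (neg_ne_zero.2 ha0)) (.of_isUnitIn_plusPart h)

theorem IsRCia.hasFactorization_aeval (hR : IsRCia ι) (hM : IsMackeyComplete A) {Z : A}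
    (hZ : ι Z = circleZPow 1) {p : Polynomial ℂ} (hp : ∀ z : Circle, p.eval (z : ℂ) ≠ 0) :
    HasFactorization ι (Polynomial.aeval Z p) := by
  have h0 : p ≠ 0 := fun h => hp 1 (by simp [h])
  induction hn : p.natDegree generalizing p with
  | zero =>
    obtain ⟨c, rfl⟩ := Polynomial.natDegree_eq_zero.1 hn
    rw [Polynomial.aeval_C]
    exact hasFactorization_algebraMap (by simpa using hp 1)
  | succ n ih =>
    obtain ⟨a, ha⟩ := IsAlgClosed.exists_root p (by
      rw [Polynomial.degree_eq_natDegree h0, hn]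
      exact_mod_cast n.succ_ne_zero)
    obtain ⟨q, rfl⟩ := Polynomial.dvd_iff_isRoot.2 ha
    have hq0 : q ≠ 0 := right_ne_zero_of_mul h0
    rw [Polynomial.natDegree_mul (Polynomial.X_sub_C_ne_zero a) hq0,
      Polynomial.natDegree_X_sub_C] at hn
    rw [map_mul, map_sub, Polynomial.aeval_X, Polynomial.aeval_C]
    refine (hR.hasFactorization_sub hM hZ fun h => ?_).mul
      (ih (fun z h => hp z (by simp [h])) hq0 (by omega))
    exact hp ⟨a, mem_sphere_zero_iff_norm.2 h⟩ (by simp)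

theorem IsRCia.hasFactorization_of_circleRational (hR : IsRCia ι) (hM : IsMackeyComplete A) {r : A}
    (hr : ι r ∈ circleRational) (hu : IsUnit r) : HasFactorization ι r := by
  obtain ⟨Z, hZ⟩ := hR.exists_eq_circleZPow_one
  obtain ⟨p, q, hq, hpq⟩ := hr
  have hp : ∀ z : Circle, p.eval (z : ℂ) ≠ 0 := fun z h =>
    apply_ne_zero_of_isUnit ι hu z (by rw [hpq, h, zero_div])
  obtain ⟨b, hb⟩ := hR.exists_aeval_mul_eq_one hZ hq
  have e : r = Polynomial.aeval Z p * b := by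
    have h1 : r * Polynomial.aeval Z q = Polynomial.aeval Z p := by
      apply hR.injective
      ext z
      simp [apply_aeval hZ, hpq, hq z]
    linear_combination b * h1 - r * hb
  rw [e]
  exact (hR.hasFactorization_aeval hM hZ hp).mul ((hR.hasFactorization_aeval hM hZ hq).inv hb)

theorem IsRCia.hasFactorization_of_isUnit (hR : IsRCia ι) (hdec : IsDecomposing ι)
    (hM : IsMackeyComplete A) {g : A} (hg : IsUnit g) : HasFactorization ι g := by
  have hc : Continuous fun a : A => 1 - a := by fun_prop
  have hU : {a : A | IsUnit (1 - a)} ∈ 𝓝 (0 : A) :=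
    (isOpen_units.preimage hc).mem_nhds (by simp)
  obtain ⟨V, ⟨hV, hVb⟩, hVU⟩ := (nhds_basis_balanced ℂ A).mem_iff.1 hU
  -- The factor `2` lets the balanced set `V` absorb all `w` with `‖w‖ ≤ 2`, the disc required by
  -- `exists_log`.
  have hcont : ContinuousAt (fun r : A => (2 : ℂ) • (g * Ring.inverse r - 1)) g := by
    have : ContinuousAt (Ring.inverse : A → A) g :=
      continuousOn_inverse.continuousAt (isOpen_units.mem_nhds hg)
    fun_prop
  have hev : ∀ᶠ r in 𝓝 g, (2 : ℂ) • (g * Ring.inverse r - 1) ∈ V :=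
    hcont.eventually_mem (by simpa [Ring.mul_inverse_cancel _ hg] using hV)
  obtain ⟨r, hr, hrV, hru⟩ :=
    hR.dense_rational.inter_nhds_nonempty (hev.and (isOpen_units.mem_nhds hg))
  obtain ⟨u, hu⟩ := exists_log ι hM (x := g * Ring.inverse r - 1) fun w hw => by
    have h : (w / 2) • (2 : ℂ) • (g * Ring.inverse r - 1) ∈ V := hVb.smul_mem (by
      rw [norm_div, Complex.norm_ofNat]
      linarith) hrV
    rw [smul_smul, div_mul_cancel₀ _ two_ne_zero] at h
    exact hVU h
  have e : g = r * (g * Ring.inverse r) := by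
    linear_combination (-g) * Ring.mul_inverse_cancel _ hru
  rw [e]
  exact (hR.hasFactorization_of_circleRational hM hr hru).mul
    (hR.hasFactorization_of_exp hdec hM (u := u) fun z => by simp [hu])

end Factorization

/-! ### Continuous logarithms and the winding number -/

section Winding

/-- Each root `a` lies outside the closed disc, so in `z - a = -a (1 - z / a)` the bracket has a
principal logarithm on the circle. -/
theorem exists_continuous_log_eval {p : Polynomial ℂ} (hp : ∀ z : ℂ, ‖z‖ ≤ 1 → p.eval z ≠ 0) :
    ∃ L : C(Circle, ℂ), ∀ z, Complex.exp (L z) = p.eval (z : ℂ) := by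
  have h0 : p ≠ 0 := fun h => hp 0 (by simp) (by simp [h])
  induction hn : p.natDegree generalizing p with
  | zero =>
    obtain ⟨c, rfl⟩ := Polynomial.natDegree_eq_zero.1 hn
    exact ⟨.const _ (Complex.log c), fun z => by
      simpa using Complex.exp_log (by simpa using h0)⟩
  | succ n ih =>
    obtain ⟨a, ha⟩ := IsAlgClosed.exists_root p (by
      rw [Polynomial.degree_eq_natDegree h0, hn]
      exact_mod_cast n.succ_ne_zero)
    obtain ⟨q, rfl⟩ := Polynomial.dvd_iff_isRoot.2 ha
    have hq0 : q ≠ 0 := right_ne_zero_of_mul h0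
    rw [Polynomial.natDegree_mul (Polynomial.X_sub_C_ne_zero a) hq0,
      Polynomial.natDegree_X_sub_C] at hn
    obtain ⟨L, hL⟩ := ih (fun z hz h => hp z hz (by simp [h])) hq0 (by omega)
    have ha1 : 1 < ‖a‖ := by
      by_contra! h
      exact hp a h (by simp)
    have ha0 : a ≠ 0 := norm_pos_iff.1 (one_pos.trans ha1)
    have hs : ∀ z : Circle, 1 + -(z : ℂ) / a ∈ Complex.slitPlane := fun z => by
      refine Complex.mem_slitPlane_of_norm_lt_one ?_
      rw [norm_div, norm_neg, Circle.norm_coe]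
      exact (div_lt_one (one_pos.trans ha1)).2 ha1
    have hc : Continuous fun z : Circle => Complex.log (1 + -(z : ℂ) / a) :=
      Continuous.clog (by fun_prop) hs
    refine ⟨.const _ (Complex.log (-a)) + ⟨_, hc⟩ + L, fun z => ?_⟩
    simp only [ContinuousMap.add_apply, ContinuousMap.const_apply, ContinuousMap.coe_mk,
      Complex.exp_add, hL, Complex.exp_log (neg_ne_zero.2 ha0),
      Complex.exp_log (Complex.slitPlane_ne_zero (hs z)), Polynomial.eval_mul,
      Polynomial.eval_sub, Polynomial.eval_X, Polynomial.eval_C]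
    field_simp
    ring

/-- The polynomial functions on the unit circle. -/
noncomputable def circlePolynomial : Submodule ℂ C(Circle, ℂ) :=
  LinearMap.range (Polynomial.aeval (circleZPow 1)).toLinearMap

theorem circleZPow_mem_circlePolynomial {n : ℤ} (hn : 0 ≤ n) :
    circleZPow n ∈ circlePolynomial := by
  lift n to ℕ using hn
  refine ⟨Polynomial.X ^ n, ?_⟩
  ext z
  simp [circleZPow_apply]

theorem exists_polynomial_norm_sub_lt {f : C(Circle, ℂ)}
    (hf : f ∈ circlePolynomial.topologicalClosure) {ε : ℝ} (hε : 0 < ε) :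
    ∃ p : Polynomial ℂ, ‖Polynomial.aeval (circleZPow 1) p - f‖ < ε := by
  obtain ⟨_, ⟨p, rfl⟩, hp⟩ := Metric.mem_closure_iff.1 hf ε hε
  exact ⟨p, by simpa [dist_eq_norm, norm_sub_rev] using hp⟩

theorem aeval_circleZPow_one_apply (p : Polynomial ℂ) (z : Circle) :
    Polynomial.aeval (circleZPow 1) p z = p.eval (z : ℂ) :=
  apply_aeval (ι := AlgHom.id ℂ C(Circle, ℂ)) rfl p z

/-- An invertible element of the disc algebra has a continuous logarithm on the circle. -/
theorem exists_continuous_log {f f' : C(Circle, ℂ)} (hf : f ∈ circlePolynomial.topologicalClosure)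
    (hf' : f' ∈ circlePolynomial.topologicalClosure) (hff : f * f' = 1) :
    ∃ L : C(Circle, ℂ), ∀ z, Complex.exp (L z) = f z := by
  -- The tolerance for `q` depends on `‖P‖`, so `p` is chosen first; together they give `‖P * Q - 1‖
  -- < 1`.
  obtain ⟨p, hp⟩ := exists_polynomial_norm_sub_lt hf
    (ε := (2 * (‖f'‖ + 1))⁻¹) (by positivity)
  set P := Polynomial.aeval (circleZPow 1) p with hP
  obtain ⟨q, hq⟩ := exists_polynomial_norm_sub_lt hf' (ε := (2 * (‖P‖ + 1))⁻¹) (by positivity)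
  set Q := Polynomial.aeval (circleZPow 1) q with hQ
  have half : ∀ x y : ℝ, 0 ≤ x → 0 ≤ y → x < (2 * (y + 1))⁻¹ → x * y < 1 / 2 := by
    intro x y hx hy h
    rw [← one_div, lt_div_iff₀ (by positivity)] at h
    nlinarith
  have h1 : ‖P * f' - 1‖ < 1 / 2 := by
    rw [← hff, ← sub_mul]
    exact (norm_mul_le _ _).trans_lt (half _ _ (norm_nonneg _) (norm_nonneg _) hp)
  have h2 : ‖P * Q - 1‖ < 1 := by
    have e : P * Q - 1 = (Q - f') * P + (P * f' - 1) := by ring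
    rw [e]
    have := (norm_mul_le _ _).trans_lt (half _ _ (norm_nonneg _) (norm_nonneg _) hq)
    linarith [norm_add_le ((Q - f') * P) (P * f' - 1)]
  have hle : ∀ z : Circle, ‖p.eval (z : ℂ) * q.eval (z : ℂ) - 1‖ ≤ ‖P * Q - 1‖ := fun z => by
    simpa [hP, hQ, circleZPow_apply] using (P * Q - 1).norm_coe_le_norm z
  -- The maximum principle carries `‖p q - 1‖ < 1` from the circle into the disc, where `p` thus has
  -- no zero.
  have hpz : ∀ z : ℂ, ‖z‖ ≤ 1 → p.eval z ≠ 0 := by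
    intro z hz h
    have hd : DiffContOnCl ℂ (fun z => p.eval z * q.eval z - 1) (Metric.ball 0 1) :=
      ((p.differentiable.mul q.differentiable).sub_const 1).diffContOnCl
    have := Complex.norm_le_of_forall_mem_frontier_norm_le Metric.isBounded_ball hd
      (C := ‖P * Q - 1‖) (fun w hw => hle ⟨w, by
        rwa [frontier_ball _ one_ne_zero] at hw⟩) (z := z)
      (by rw [closure_ball _ one_ne_zero]; simpa using hz)
    simp [h] at this
    linarith
  obtain ⟨L, hL⟩ := exists_continuous_log_eval hpz
  have hs : ∀ z, (P * f') z ∈ Complex.slitPlane := fun z => by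
    have h := (P * f' - 1).norm_coe_le_norm z
    have := Complex.mem_slitPlane_of_norm_lt_one (z := (P * f' - 1) z) (by linarith)
    simpa using this
  have hc : Continuous fun z => Complex.log ((P * f') z) :=
    Continuous.clog (P * f').continuous hs
  -- Here `f = P / (P * f')`, and the denominator is within `1 / 2` of `1`.
  refine ⟨L - ⟨_, hc⟩, fun z => ?_⟩
  have hz : f z * f' z = 1 := by simpa using congrArg (fun h : C(Circle, ℂ) => h z) hff
  have hne := Complex.slitPlane_ne_zero (hs z)
  simp only [ContinuousMap.sub_apply, ContinuousMap.coe_mk, Complex.exp_sub, Complex.exp_log hne,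
    hL]
  rw [div_eq_iff hne, ContinuousMap.mul_apply, hP, aeval_circleZPow_one_apply]
  linear_combination (-p.eval (z : ℂ)) * hz

variable {A : Type*} [CommRing A] [Algebra ℂ A] [TopologicalSpace A] [IsContinuousInverseAlgebra A]
  {ι : A →ₐ[ℂ] C(Circle, ℂ)}

/-- Continuity of `ι` passes from closures in `A` to uniform closures on the circle. -/
theorem topologicalClosure_comap_span_le {S : Submodule ℂ C(Circle, ℂ)}
    (hS : IsClosed (S : Set C(Circle, ℂ))) {T : Set ℤ} (hT : ∀ n ∈ T, circleZPow n ∈ S) :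
    ((Submodule.span ℂ (circleZPow '' T)).comap ι.toLinearMap).topologicalClosure ≤
      S.comap ι.toLinearMap := by
  refine Submodule.topologicalClosure_minimal _ (Submodule.comap_mono (Submodule.span_le.2 ?_))
    (hS.preimage ι.continuous_of_isContinuousInverseAlgebra)
  rintro _ ⟨n, hn, rfl⟩
  exact hT n hn

theorem apply_mem_of_mem_plusPart {a : A} (ha : a ∈ plusPart ι) :
    ι a ∈ circlePolynomial.topologicalClosure :=
  topologicalClosure_comap_span_le (Submodule.isClosed_topologicalClosure _) (fun _ hn =>
    Submodule.le_topologicalClosure _ (circleZPow_mem_circlePolynomial hn)) ha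

/-- Composition with the inversion of the unit circle. -/
noncomputable def circleReflection : C(Circle, ℂ) →ₐ[ℂ] C(Circle, ℂ) :=
  ContinuousMap.compRightAlgHom ℂ ℂ ⟨fun z : Circle => z⁻¹, continuous_inv⟩

theorem circleReflection_apply (f : C(Circle, ℂ)) (z : Circle) :
    circleReflection f z = f z⁻¹ := rfl

theorem continuous_circleReflection : Continuous circleReflection :=
  ContinuousMap.continuous_precomp _

theorem circleReflection_circleZPow (n : ℤ) :
    circleReflection (circleZPow n) = circleZPow (-n) := by
  ext z
  simp [circleReflection_apply, circleZPow_apply]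

/-- Under `z ↦ z⁻¹` nonpositive powers become nonnegative ones, so `A⁻` reduces to the polynomial
case. -/
theorem circleReflection_apply_mem_of_mem_minusPart {a : A} (ha : a ∈ minusPart ι) :
    circleReflection (ι a) ∈ circlePolynomial.topologicalClosure := by
  have hmem : ∀ n : ℤ, n ≤ 0 → circleZPow n ∈
      circlePolynomial.topologicalClosure.comap circleReflection.toLinearMap := fun n hn => by
    refine Submodule.le_topologicalClosure _ ?_
    simpa [circleReflection_circleZPow] using circleZPow_mem_circlePolynomial (neg_nonneg.2 hn)
  have hle : minusPart ι ≤ (circlePolynomial.topologicalClosure.comap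
      circleReflection.toLinearMap).comap ι.toLinearMap := by
    refine sup_le ?_ (topologicalClosure_comap_span_le
      ((Submodule.isClosed_topologicalClosure _).preimage continuous_circleReflection)
      fun n hn => hmem n (le_of_lt hn))
    rw [Submodule.span_singleton_le_iff_mem]
    simpa [circleZPow_zero] using hmem 0 le_rfl
  exact hle ha

theorem IsUnitIn.exists_continuous_log_plusPart {a : A} (ha : IsUnitIn (plusPart ι) a) :
    ∃ L : C(Circle, ℂ), ∀ z, Complex.exp (L z) = ι a z := by
  obtain ⟨ha, b, hb, hab⟩ := ha
  exact exists_continuous_log (apply_mem_of_mem_plusPart ha) (apply_mem_of_mem_plusPart hb)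
    (by rw [← map_mul, hab, map_one])

theorem IsUnitIn.exists_continuous_log_minusPart {a : A} (ha : IsUnitIn (minusPart ι) a) :
    ∃ L : C(Circle, ℂ), ∀ z, Complex.exp (L z) = ι a z := by
  obtain ⟨ha, b, hb, hab⟩ := ha
  obtain ⟨L, hL⟩ := exists_continuous_log (circleReflection_apply_mem_of_mem_minusPart ha)
    (circleReflection_apply_mem_of_mem_minusPart hb)
    (by rw [← map_mul, ← map_mul, hab, map_one, map_one])
  refine ⟨circleReflection L, fun z => ?_⟩
  rw [circleReflection_apply, hL, circleReflection_apply, inv_inv]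

/-- Along the loop `L` returns to its initial value, so only `k t i` contributes to the increment.
-/
theorem hasWindingNumber_of_exp {f : C(Circle, ℂ)} {L : C(Circle, ℂ)} {k : ℤ}
    (h : ∀ z, f z = Complex.exp (L z) * (z : ℂ) ^ k) : HasWindingNumber f k := by
  refine ⟨⟨fun t => L (Circle.exp t) + k * (t * Complex.I), by fun_prop⟩, fun t => ?_, ?_⟩
  · simp [h, Complex.exp_add, Complex.exp_int_mul]
  · simp

end Winding

theorem proposition1p1 {A : Type*} [CommRing A] [Algebra ℂ A] [TopologicalSpace A]
    [IsContinuousInverseAlgebra A] (ι : A →ₐ[ℂ] C(Circle, ℂ)) (hR : IsRCia ι)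
    (hdec : IsDecomposing ι) (hM : IsMackeyComplete A) (g : A) (hg : IsUnit g) :
    (∃ (gp gm : A) (κ : ℤ), IsUnitIn (plusPart ι) gp ∧ IsUnitIn (minusPart ι) gm ∧
      ι g = ι gp * circleZPow κ * ι gm) ∧
    (∀ (gp gm : A) (κ : ℤ), IsUnitIn (plusPart ι) gp → IsUnitIn (minusPart ι) gm →
      ι g = ι gp * circleZPow κ * ι gm → HasWindingNumber (ι g) κ) := by
  refine ⟨hR.hasFactorization_of_isUnit hdec hM hg, fun gp gm κ hp hm h => ?_⟩
  obtain ⟨L, hL⟩ := hp.exists_continuous_log_plusPart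
  obtain ⟨L', hL'⟩ := hm.exists_continuous_log_minusPart
  refine hasWindingNumber_of_exp (L := L + L') fun z => ?_
  rw [h, ContinuousMap.add_apply, Complex.exp_add, hL, hL']
  simp only [ContinuousMap.mul_apply, circleZPow_apply]
  ring
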